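/- Let $p$ be a prime, $q$ a power of $p$, $n\ge 2$, and let $d>2$ be an integer with $p\nmid d$. For a homogeneous polynomial $H\in\mathbb F_q[X_0,\dots,X_m]$, write $H_i=\partial H/\partial X_i$; the hypersurface $H=0$ in $\mathbb P^m(\overline{\mathbb F}_q)$ is called $\mathbb F_q$-Frobenius nonclassical if for every nonsingular point $P$ of it (a point $P$ with $H(P)=0$ and $H_i(P)\neq0$ for some $i$) the image $\Phi_q(P)$ of $P$ under the $q$-Frobenius map $(x_0:\dots:x_m)\mapsto(x_0^q:\dots:x_m^q)$ lies on the tangent hyperplane $\sum_i H_i(P)X_i=0$ at $P$. Let $\mathcal S: F=0$ in $\mathbb P^n$ be a smooth absolutely irreducible hypersurface of degree $d$, where $F\in\mathbb F_q[X_0,\dots,X_n]$ is homogeneous of the form $F=G(X_0,\dots,X_{n-1})-X_n^d$. Then $\mathcal S$ is $\mathbb F_q$-Frobenius nonclassical if and only if there is a positive integer $k$ such that $$kd=d-1+q,\qquad p\mid k,\qquad G^k=\sum_{i=0}^{n-1}G_iX_i^q .$$ In particular, if $\mathcal S$ is $\mathbb F_q$-Frobenius nonclassical, then the hypersurface $\mathcal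 V: G=0$ in $\mathbb P^{n-1}$ (which is absolutely irreducible when $n\ge3$) is $\mathbb F_q$-Frobenius nonclassical as well. -/

import Mathlib

open MvPolynomial

namespace FrobNC

/-- Geometric points of the projective space with homogeneous coordinates indexed by `σ`,
over the algebraic closure of `K`. -/
abbrev ProjPts (σ K : Type*) [Field K] : Type _ :=
  Projectivization (AlgebraicClosure K) (σ → AlgebraicClosure K)

section

variable {σ K : Type*} [Field K]

/-- `F` is absolutely irreducible: irreducible over the algebraic closure of `K`. -/
def AbsolutelyIrreducible (F : MvPolynomial σ K) : Prop :=
  Irreducible (MvPolynomial.map (algebraMap K (AlgebraicClosure K)) F)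

/-- The set of geometric points of the projective hypersurface `F = 0`.
For homogeneous `F` the choice of homogeneous coordinates of `P` is irrelevant, here and in
the definitions below. -/
def hypersurface (F : MvPolynomial σ K) : Set (ProjPts σ K) :=
  {P | aeval P.rep F = 0}

/-- The nonsingular locus of the hypersurface `F = 0`: its points at which some partial
derivative of `F` does not vanish. -/
def regularLocus (F : MvPolynomial σ K) : Set (ProjPts σ K) :=
  {P | P ∈ hypersurface F ∧ ∃ i, aeval P.rep (pderiv i F) ≠ 0}

/-- The hypersurface `F = 0` is smooth. -/
def IsSmoothHypersurface (F : MvPolynomial σ K) : Prop :=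
  regularLocus F = hypersurface F

/-- The tangent hyperplane at `P`, given by `∑ i, (∂F/∂X_i)(P) * X_i = 0`. -/
def tangentHyperplane [Fintype σ] (F : MvPolynomial σ K) (P : ProjPts σ K) :
    Set (ProjPts σ K) :=
  {Q | ∑ i, aeval P.rep (pderiv i F) * Q.rep i = 0}

/-- The Frobenius map, raising homogeneous coordinates to the `q`-th power. -/
noncomputable def frobeniusMap (q : ℕ) (P : ProjPts σ K) : ProjPts σ K :=
  Projectivization.mk (AlgebraicClosure K) (fun i => P.rep i ^ q) (fun h =>
    P.rep_nonzero (funext fun i => eq_zero_of_pow_eq_zero (congrFun h i)))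

/-- The Frobenius nonclassical locus of the hypersurface `F = 0`: the regular points whose
image under Frobenius lies on the tangent hyperplane. -/
def frobeniusNonclassicalLocus [Fintype σ] (q : ℕ) (F : MvPolynomial σ K) :
    Set (ProjPts σ K) :=
  {P | P ∈ regularLocus F ∧ frobeniusMap q P ∈ tangentHyperplane F P}

/-- The hypersurface `F = 0` is Frobenius nonclassical (with respect to the `q`-Frobenius). -/
def IsFrobeniusNonclassical [Fintype σ] (q : ℕ) (F : MvPolynomial σ K) : Prop :=
  frobeniusNonclassicalLocus q F = regularLocus F

end

end FrobNC

namespace FrobNC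

/-! Nonclassicality says that `∑ F_i X_i^q = ∑ G_i X_i^q - d X_n^(d-1+q)` vanishes on `F = 0`, which
for irreducible `F` means that `F` divides it. Reducing modulo `X_n^d - G` as polynomials in `X_n`
forces `k d = d - 1 + q` and `d G^k = ∑ G_i X_i^q`.

If `p ∤ k`, apply `∂/∂X_j` and evaluate at a nonzero rational point, where `x_i^q = x_i`: Euler's
formula gives `d k G^(k-1) G_j = (d-1) G_j`. As `d k = d - 1 ≠ 0` in `K` and some `G_j ≠ 0`, the
form `G^(k-1)`, of degree `q - 1`, equals 1 at every nonzero rational point, against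
Chevalley–Warning. So `p ∣ k`, whence `d = 1` in `K` and the factor `d` disappears. Conversely, the
sum becomes `G^k - (X_n^d)^k`, a multiple of `F`.

The identity makes `∑ G_i X_i^q` vanish on `G = 0`. Irreducibility of `G` for `n ≥ 3` holds because
two factors would meet in a singular point. -/

theorem aeval_smul_of_isHomogeneous {σ R A : Type*} [CommSemiring R] [CommSemiring A]
    [Algebra R A] {F : MvPolynomial σ R} {d : ℕ} (hF : F.IsHomogeneous d) (a : A) (x : σ → A) :
    aeval (a • x) F = a ^ d * aeval x F := by
  simp only [aeval_def, eval₂_eq, Finset.mul_sum]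
  refine Finset.sum_congr rfl fun m hm => ?_
  rw [hF.degree_eq_sum_deg_support hm, ← Finset.prod_pow_eq_pow_sum]
  simp only [Pi.smul_apply, smul_eq_mul, mul_pow, Finset.prod_mul_distrib]
  ring

/-! ### Projective conditions in terms of coordinate vectors -/

section Projective

variable {σ K : Type*} [Field K]

theorem exists_smul_rep_mk (x : σ → AlgebraicClosure K) (hx : x ≠ 0) :
    ∃ a : AlgebraicClosure K, a ≠ 0 ∧
      (Projectivization.mk (AlgebraicClosure K) x hx : ProjPts σ K).rep = a • x := by
  obtain ⟨a, ha⟩ := Projectivization.exists_smul_eq_mk_rep (AlgebraicClosure K) x hx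
  exact ⟨a, a.ne_zero, ha.symm⟩

theorem isSmoothHypersurface_iff {F : MvPolynomial σ K} {d : ℕ} (hF : F.IsHomogeneous d) :
    IsSmoothHypersurface F ↔ ∀ x : σ → AlgebraicClosure K, x ≠ 0 → aeval x F = 0 →
      ∃ i, aeval x (pderiv i F) ≠ 0 := by
  constructor
  · intro h x hx hx0
    obtain ⟨a, ha, hr⟩ := exists_smul_rep_mk x hx
    have hP : Projectivization.mk (AlgebraicClosure K) x hx ∈ hypersurface F := by
      simp only [hypersurface, Set.mem_ofPred_eq, hr, aeval_smul_of_isHomogeneous hF, hx0, mul_zero]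
    rw [← h] at hP
    obtain ⟨i, hi⟩ := hP.2
    refine ⟨i, fun h0 => hi ?_⟩
    rw [hr, aeval_smul_of_isHomogeneous hF.pderiv, h0, mul_zero]
  · intro h
    ext P
    exact ⟨fun hP => hP.1, fun hP => ⟨hP, h _ P.rep_nonzero hP⟩⟩

theorem isFrobeniusNonclassical_iff [Fintype σ] {F : MvPolynomial σ K} {d : ℕ}
    (hF : F.IsHomogeneous d) (q : ℕ) :
    IsFrobeniusNonclassical q F ↔ ∀ x : σ → AlgebraicClosure K, x ≠ 0 → aeval x F = 0 →
      (∃ i, aeval x (pderiv i F) ≠ 0) → ∑ i, aeval x (pderiv i F) * x i ^ q = 0 := by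
  have key : ∀ P : ProjPts σ K, frobeniusMap q P ∈ tangentHyperplane F P ↔
      ∑ i, aeval P.rep (pderiv i F) * P.rep i ^ q = 0 := by
    intro P
    obtain ⟨a, ha, hr⟩ := exists_smul_rep_mk (K := K) (fun i => P.rep i ^ q) (fun h =>
      P.rep_nonzero (funext fun i => eq_zero_of_pow_eq_zero (congrFun h i)))
    have : ∑ i, aeval P.rep (pderiv i F) * (frobeniusMap q P).rep i =
        a * ∑ i, aeval P.rep (pderiv i F) * P.rep i ^ q := by
      rw [Finset.mul_sum]
      refine Finset.sum_congr rfl fun i _ => ?_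
      rw [frobeniusMap, hr, Pi.smul_apply, smul_eq_mul]
      ring
    simp only [tangentHyperplane, Set.mem_ofPred_eq, this, mul_eq_zero, ha, false_or]
  constructor
  · intro h x hx hx0 ⟨i, hi⟩
    obtain ⟨a, ha, hr⟩ := exists_smul_rep_mk x hx
    have hP : Projectivization.mk (AlgebraicClosure K) x hx ∈ regularLocus F := by
      refine ⟨?_, i, ?_⟩
      · simp only [hypersurface, Set.mem_ofPred_eq, hr, aeval_smul_of_isHomogeneous hF, hx0,
          mul_zero]
      · rw [hr, aeval_smul_of_isHomogeneous hF.pderiv]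
        exact mul_ne_zero (pow_ne_zero _ ha) hi
    rw [← h] at hP
    have h2 := (key _).1 hP.2
    rw [hr] at h2
    have h3 : a ^ (d - 1) * a ^ q * ∑ i, aeval x (pderiv i F) * x i ^ q = 0 := by
      rw [← h2, Finset.mul_sum]
      refine Finset.sum_congr rfl fun i _ => ?_
      rw [aeval_smul_of_isHomogeneous hF.pderiv, Pi.smul_apply, smul_eq_mul]
      ring
    exact (mul_eq_zero.1 h3).resolve_left (mul_ne_zero (pow_ne_zero _ ha) (pow_ne_zero _ ha))
  · intro h
    ext P
    exact ⟨fun hP => hP.1, fun hP => ⟨hP, (key P).2 (h _ P.rep_nonzero hP.1 hP.2)⟩⟩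

end Projective

/-! ### Common zeros and factors of homogeneous polynomials -/

section CommonZeros

variable {k : Type*} [Field k]

/-- The prime ideal generated by the first `j` variables. -/
noncomputable def initialVarsIdeal (k : Type*) [Field k] (n j : ℕ) :
    Ideal (MvPolynomial (Fin n) k) :=
  RingHom.ker (aeval fun i : Fin n => if (i : ℕ) < j then (0 : MvPolynomial (Fin n) k) else X i)

instance (n j : ℕ) : (initialVarsIdeal k n j).IsPrime := RingHom.ker_isPrime _

theorem initialVarsIdeal_lt_succ {n j : ℕ} (hj : j < n) :
    initialVarsIdeal k n j < initialVarsIdeal k n (j + 1) := by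
  refine lt_of_le_of_ne ?_ fun h => ?_
  · intro f hf
    rw [initialVarsIdeal, RingHom.mem_ker] at hf ⊢
    have h := congrArg (aeval fun i : Fin n =>
      if (i : ℕ) < j + 1 then (0 : MvPolynomial (Fin n) k) else X i) hf
    rw [map_zero, ← AlgHom.comp_apply, comp_aeval] at h
    refine Eq.trans ?_ h
    congr 2
    funext i
    by_cases h1 : (i : ℕ) < j
    · simp [h1, Nat.lt_succ_of_lt h1]
    · simp [h1]
  · have h1 : X ⟨j, hj⟩ ∈ initialVarsIdeal k n (j + 1) := by
      simp [initialVarsIdeal, RingHom.mem_ker]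
    rw [← h] at h1
    simp [initialVarsIdeal, RingHom.mem_ker] at h1

theorem le_height_initialVarsIdeal {n j : ℕ} (hj : j ≤ n) :
    (j : ℕ∞) ≤ (initialVarsIdeal k n j).height := by
  induction j with
  | zero => simp
  | succ j ih =>
    refine le_trans ?_
      (Ideal.height_add_one_le_of_lt_of_isPrime (initialVarsIdeal_lt_succ (k := k) hj))
    push_cast
    gcongr
    exact ih (Nat.le_of_succ_le hj)

/-- If the origin were the only common zero, its maximal ideal would be the radical of `(A, B)`,
hence of height at most 2 by Krull's theorem; the chain of `initialVarsIdeal`s shows that its height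
is at least `n`. -/
theorem exists_common_zero_ne_zero [IsAlgClosed k] {n : ℕ} (hn : 3 ≤ n)
    {A B : MvPolynomial (Fin n) k} (hA : aeval (0 : Fin n → k) A = 0)
    (hB : aeval (0 : Fin n → k) B = 0) :
    ∃ x : Fin n → k, x ≠ 0 ∧ aeval x A = 0 ∧ aeval x B = 0 := by
  by_contra! hcon
  set m : Ideal (MvPolynomial (Fin n) k) := vanishingIdeal k {(0 : Fin n → k)} with hm
  have hI : (Ideal.span {A, B}).radical = m := by
    rw [← vanishingIdeal_zeroLocus_eq_radical (K := k), zeroLocus_span, hm]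
    congr 1
    ext x
    simp only [Set.mem_insert_iff, Set.mem_singleton_iff, forall_eq_or_imp, forall_eq,
      Set.mem_ofPred_eq]
    constructor
    · rintro ⟨h1, h2⟩
      by_contra hx
      exact hcon x hx h1 h2
    · rintro rfl
      exact ⟨hA, hB⟩
  have hmin : m ∈ (Ideal.span {A, B}).minimalPrimes := by
    rw [← Ideal.radical_minimalPrimes, hI, Ideal.minimalPrimes_eq_subsingleton_self]
    rfl
  have h2 := Ideal.height_le_card_of_mem_minimalPrimes_span (Set.toFinite _) hmin
  have h3 : initialVarsIdeal k n n ≤ m := by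
    intro f hf
    rw [initialVarsIdeal, RingHom.mem_ker] at hf
    have h := congrArg (aeval (0 : Fin n → k)) hf
    rw [map_zero, ← AlgHom.comp_apply, comp_aeval] at h
    rw [hm, mem_vanishingIdeal_singleton_iff]
    refine Eq.trans ?_ h
    congr 2
    funext i
    simp
  have h4 := (le_height_initialVarsIdeal (k := k) le_rfl).trans (Ideal.height_mono h3)
  have h5 : n ≤ ({A, B} : Set (MvPolynomial (Fin n) k)).ncard := by exact_mod_cast h4.trans h2
  have h6 := Set.ncard_insert_le A {B}
  rw [Set.ncard_singleton] at h6
  omega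

theorem aeval_polynomialC_X {σ : Type*} (f : MvPolynomial σ k) :
    aeval (fun i => Polynomial.C (X i)) f = Polynomial.C f := by
  have : aeval (fun i => Polynomial.C (X i)) =
      (Algebra.ofId (MvPolynomial σ k) (Polynomial (MvPolynomial σ k))).restrictScalars k := by
    ext i
    simp [Algebra.ofId_apply]
  rw [this]
  rfl

/-- Substituting `T X_i` for `X_i` turns `A * B` into a monomial in `T`, so each factor becomes a
monomial in `T` too. If `A(0) ≠ 0`, that monomial has degree 0, and `A` is the constant `A(0)`, a
unit. -/
theorem aeval_zero_eq_zero_of_mul_isHomogeneous {σ : Type*} {A B : MvPolynomial σ k} {d : ℕ}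
    (h : (A * B).IsHomogeneous d) (h0 : A * B ≠ 0) (hA : ¬ IsUnit A) :
    aeval (0 : σ → k) A = 0 := by
  let Φ : MvPolynomial σ k →ₐ[k] Polynomial (MvPolynomial σ k) :=
    aeval ((Polynomial.X : Polynomial (MvPolynomial σ k)) • fun i => Polynomial.C (X i))
  have hev : ∀ (t : MvPolynomial σ k) (f : MvPolynomial σ k),
      (Φ f).eval t = aeval (fun i => t * X i) f := by
    intro t f
    have : ((Polynomial.aeval t).restrictScalars k).comp Φ = aeval (fun i => t * X i) := by
      ext i
      simp [Φ, mul_comm (X i) t]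
    have h := DFunLike.congr_fun this f
    simpa [Polynomial.aeval_def] using h
  have h1 : ∀ f, (Φ f).eval 1 = f := fun f => by simp [hev]
  have hz : ∀ f, (Φ f).eval 0 = C (aeval (0 : σ → k) f) := fun f => by
    rw [hev]
    have : aeval (fun i => 0 * X i) = (Algebra.ofId k (MvPolynomial σ k)).comp
        (aeval (0 : σ → k)) := by
      ext i
      simp
    rw [this]
    rfl
  have hAB : Φ A * Φ B = Polynomial.C (A * B) * Polynomial.X ^ d := by
    rw [← map_mul, aeval_smul_of_isHomogeneous h, aeval_polynomialC_X, mul_comm]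
  have hne : Φ A * Φ B ≠ 0 := fun h => h0 (by rw [← h1 (A * B), map_mul, h, Polynomial.eval_zero])
  have hdeg := Polynomial.natDegree_mul (left_ne_zero_of_mul hne) (right_ne_zero_of_mul hne)
  have htr := Polynomial.natTrailingDegree_mul (left_ne_zero_of_mul hne)
    (right_ne_zero_of_mul hne)
  rw [hAB, Polynomial.natDegree_C_mul_X_pow _ _ h0] at hdeg
  rw [hAB, Polynomial.C_mul_X_pow_eq_monomial, Polynomial.natTrailingDegree_monomial h0] at htr
  have ha := (Φ A).natTrailingDegree_le_natDegree
  have hb := (Φ B).natTrailingDegree_le_natDegree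
  by_contra hA0
  have hc : (Φ A).coeff 0 ≠ 0 := by
    rw [Polynomial.coeff_zero_eq_eval_zero, hz]
    simpa using hA0
  have ht : (Φ A).natTrailingDegree = 0 := by
    have := Polynomial.natTrailingDegree_le_of_ne_zero hc
    omega
  have hd0 : (Φ A).natDegree = 0 := by omega
  rw [Polynomial.natDegree_eq_zero] at hd0
  obtain ⟨a, ha'⟩ := hd0
  have e1 := h1 A
  have e2 := hz A
  rw [← ha', Polynomial.eval_C] at e1 e2
  apply hA
  rw [← e1, e2]
  exact (IsUnit.mk0 _ hA0).map C

end CommonZeros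

/-! ### From vanishing to divisibility -/

theorem map_dvd_map_of_aeval_eq_zero {σ K : Type*} [Finite σ] [Field K] {F H : MvPolynomial σ K}
    (hirr : AbsolutelyIrreducible F)
    (h : ∀ x : σ → AlgebraicClosure K, aeval x F = 0 → aeval x H = 0) :
    map (algebraMap K (AlgebraicClosure K)) F ∣ map (algebraMap K (AlgebraicClosure K)) H := by
  have hpr : (Ideal.span {map (algebraMap K (AlgebraicClosure K)) F}).IsPrime :=
    (Ideal.span_singleton_prime hirr.ne_zero).2 hirr.prime
  rw [← Ideal.mem_span_singleton, ← hpr.radical,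
    ← vanishingIdeal_zeroLocus_eq_radical (K := AlgebraicClosure K), mem_vanishingIdeal_iff,
    zeroLocus_span]
  intro x hx
  simp only [Set.mem_singleton_iff, forall_eq, Set.mem_ofPred_eq, aeval_map_algebraMap] at hx ⊢
  exact h x hx

/-- With `m = k d + r`, `X^m ≡ g^k X^r` modulo `X^d - g`. The remainder `s - c g^k X^r` has degree
below `d`, so it is zero, and `c g^k ≠ 0` forces `r = 0`. -/
theorem eq_mul_pow_of_X_pow_sub_C_dvd {R : Type*} [CommRing R] [IsDomain R] {g s c : R}
    {d m : ℕ} (hd : 0 < d) (hg : g ≠ 0) (hc : c ≠ 0)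
    (h : (Polynomial.X ^ d - Polynomial.C g) ∣
      (Polynomial.C s - Polynomial.C c * Polynomial.X ^ m : Polynomial R)) :
    ∃ k, k * d = m ∧ c * g ^ k = s := by
  refine ⟨m / d, ?_⟩
  have hm := Nat.div_add_mod m d
  set k := m / d
  set r := m % d with hr
  have hrd : r < d := Nat.mod_lt _ hd
  have h1 : (Polynomial.X ^ d - Polynomial.C g) ∣
      ((Polynomial.X ^ d) ^ k - Polynomial.C g ^ k : Polynomial R) := sub_dvd_pow_sub_pow _ _ _
  have h2 : (Polynomial.X ^ d - Polynomial.C g) ∣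
      (Polynomial.C s - Polynomial.C (c * g ^ k) * Polynomial.X ^ r : Polynomial R) := by
    have := dvd_add h (h1.mul_left (Polynomial.C c * Polynomial.X ^ r))
    convert this using 1
    rw [← hm, Polynomial.C_mul, Polynomial.C_pow]
    ring
  have h3 : (Polynomial.C s - Polynomial.C (c * g ^ k) * Polynomial.X ^ r : Polynomial R) = 0 := by
    refine Polynomial.eq_zero_of_dvd_of_degree_lt h2 ?_
    rw [Polynomial.degree_X_pow_sub_C hd]
    refine (Polynomial.degree_sub_le _ _).trans_lt (max_lt ?_ ?_)
    · exact Polynomial.degree_C_le.trans_lt (by exact_mod_cast hd)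
    · exact (Polynomial.degree_C_mul_X_pow_le _ _).trans_lt (by exact_mod_cast hrd)
  have hcg : c * g ^ k ≠ 0 := mul_ne_zero hc (pow_ne_zero _ hg)
  have hr0 : r = 0 := by
    by_contra hr0
    have h4 := congrArg (fun f => Polynomial.coeff f r) h3
    rw [Polynomial.coeff_sub, Polynomial.coeff_C_mul_X_pow, if_pos rfl,
      Polynomial.coeff_C_of_ne_zero hr0, zero_sub, Polynomial.coeff_zero, neg_eq_zero] at h4
    exact hcg h4
  rw [hr0, pow_zero, mul_one, ← Polynomial.C_sub, Polynomial.C_eq_zero, sub_eq_zero] at h3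
  exact ⟨by rw [← hm, hr0, add_zero, mul_comm], h3.symm⟩

/-! ### The cyclic cover `G = X_n^d` -/

section CyclicCover

variable {K : Type*} [Field K] {n d : ℕ} (G : MvPolynomial (Fin n) K)

theorem pderiv_castSucc_cyclicCover (i : Fin n) :
    pderiv i.castSucc (rename Fin.castSucc G - X (Fin.last n) ^ d) =
      rename Fin.castSucc (pderiv i G) := by
  rw [map_sub, pderiv_rename (Fin.castSucc_injective n), pderiv_pow,
    pderiv_X_of_ne (Fin.castSucc_lt_last i).ne', mul_zero, sub_zero]

theorem pderiv_last_cyclicCover :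
    pderiv (Fin.last n) (rename Fin.castSucc G - X (Fin.last n) ^ d) =
      - ((d : MvPolynomial (Fin (n + 1)) K) * X (Fin.last n) ^ (d - 1)) := by
  have h : pderiv (Fin.last n) (rename Fin.castSucc G) = 0 := by
    refine pderiv_eq_zero_of_notMem_vars fun h => ?_
    classical
    obtain ⟨i, -, hi⟩ := Finset.mem_image.1 (vars_rename _ _ h)
    exact (Fin.castSucc_lt_last i).ne hi
  rw [map_sub, h, pderiv_pow, pderiv_X_self, mul_one, zero_sub]

theorem sum_pderiv_cyclicCover (q : ℕ) :
    ∑ i, pderiv i (rename Fin.castSucc G - X (Fin.last n) ^ d) * X i ^ q =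
      rename Fin.castSucc (∑ i, pderiv i G * X i ^ q) -
        (d : MvPolynomial (Fin (n + 1)) K) * X (Fin.last n) ^ (d - 1 + q) := by
  rw [Fin.sum_univ_castSucc, pderiv_last_cyclicCover]
  simp only [pderiv_castSucc_cyclicCover, map_sum, map_mul, map_pow, rename_X]
  ring

variable {G}

theorem exists_eq_of_isFrobeniusNonclassical_cyclicCover {q : ℕ} (hd : 0 < d)
    (hdK : (d : K) ≠ 0) (hq : 0 < q) (hG : G ≠ 0)
    (hF : (rename Fin.castSucc G - X (Fin.last n) ^ d).IsHomogeneous d)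
    (hirr : AbsolutelyIrreducible (rename Fin.castSucc G - X (Fin.last n) ^ d))
    (h : IsFrobeniusNonclassical q (rename Fin.castSucc G - X (Fin.last n) ^ d)) :
    ∃ k, k * d = d - 1 + q ∧ C (d : K) * G ^ k = ∑ i, pderiv i G * X i ^ q := by
  rw [isFrobeniusNonclassical_iff hF] at h
  have hdvd := map_dvd_map_of_aeval_eq_zero hirr
    (H := ∑ i, pderiv i (rename Fin.castSucc G - X (Fin.last n) ^ d) * X i ^ q) (by
      intro x hx
      simp only [map_sum, map_mul, map_pow, aeval_X]
      -- Divisibility needs vanishing on the whole affine cone: at singular points the sum is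
      -- trivially zero, and at the origin `q > 0` suffices.
      by_cases hs : ∃ i, aeval x (pderiv i (rename Fin.castSucc G - X (Fin.last n) ^ d)) ≠ 0
      · by_cases hx0 : x = 0
        · simp [hx0, hq.ne']
        · exact h x hx0 hx hs
      · push Not at hs
        simp only [hs, zero_mul, Finset.sum_const_zero])
  rw [sum_pderiv_cyclicCover] at hdvd
  let φ := map (σ := Fin n) (algebraMap K (AlgebraicClosure K))
  -- `ψ` singles out the last variable as the polynomial variable.
  let ψ : MvPolynomial (Fin (n + 1)) (AlgebraicClosure K) →ₐ[AlgebraicClosure K]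
      Polynomial (MvPolynomial (Fin n) (AlgebraicClosure K)) :=
    aeval (Fin.lastCases Polynomial.X fun i => Polynomial.C (X i))
  have hψ : ∀ f : MvPolynomial (Fin n) K,
      ψ (map (algebraMap K (AlgebraicClosure K)) (rename Fin.castSucc f)) =
        Polynomial.C (φ f) := by
    intro f
    rw [map_rename, aeval_rename, ← aeval_polynomialC_X]
    congr 2
    funext i
    simp
  have hψX : ψ (X (Fin.last n)) = Polynomial.X := by simp [ψ]
  have hc : Polynomial.C (φ (C (d : K))) =
      (d : Polynomial (MvPolynomial (Fin n) (AlgebraicClosure K))) := by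
    simp only [φ, map_natCast]
  have h2 := map_dvd ψ hdvd
  rw [map_sub, map_sub, map_sub, map_sub, hψ, hψ, map_mul, map_mul, map_pow, map_pow, map_pow,
    map_pow, map_natCast, map_natCast, map_X, hψX, ← neg_dvd, neg_sub, ← hc] at h2
  have hφ : Function.Injective φ := map_injective _ (algebraMap K (AlgebraicClosure K)).injective
  have hdC : C (σ := Fin n) (d : K) ≠ 0 := (map_ne_zero_iff C (C_injective _ _)).2 hdK
  obtain ⟨k, hk, hk2⟩ := eq_mul_pow_of_X_pow_sub_C_dvd hd
    ((map_ne_zero_iff φ hφ).2 hG) ((map_ne_zero_iff φ hφ).2 hdC) h2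
  exact ⟨k, hk, hφ (by rw [map_mul, map_pow, hk2])⟩

/-- If all `G_i` vanish at `x`, then so does `G` by Euler's formula, `d` being invertible, and `(x :
0)` is a singular point of the cover. -/
theorem exists_pderiv_ne_zero_of_isSmoothHypersurface_cyclicCover (hd : 1 < d)
    (hdK : (d : K) ≠ 0) (hG : G.IsHomogeneous d)
    (hF : (rename Fin.castSucc G - X (Fin.last n) ^ d).IsHomogeneous d)
    (hsm : IsSmoothHypersurface (rename Fin.castSucc G - X (Fin.last n) ^ d))
    (x : Fin n → AlgebraicClosure K) (hx : x ≠ 0) : ∃ i, aeval x (pderiv i G) ≠ 0 := by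
  rw [isSmoothHypersurface_iff hF] at hsm
  by_contra! hs
  let y : Fin (n + 1) → AlgebraicClosure K := Fin.snoc x 0
  have hyx : ∀ f : MvPolynomial (Fin n) K, aeval y (rename Fin.castSucc f) = aeval x f := by
    intro f
    rw [aeval_rename]
    congr 2
    funext i
    simp [y]
  have hyl : y (Fin.last n) = 0 := by simp [y]
  have hG0 : aeval x G = 0 := by
    have h := congrArg (aeval x) hG.sum_X_mul_pderiv
    simp only [map_sum, map_mul, hs, mul_zero, Finset.sum_const_zero, nsmul_eq_mul,
      map_natCast] at h
    refine (mul_eq_zero.1 h.symm).resolve_left fun h0 => hdK ?_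
    apply (algebraMap K (AlgebraicClosure K)).injective
    rw [map_natCast, map_zero, h0]
  obtain ⟨i, hi⟩ := hsm y (fun h => hx (funext fun i => by
      simpa [y] using congrFun h i.castSucc)) (by
    rw [map_sub, hyx, hG0, map_pow, aeval_X, hyl, zero_pow (by omega), sub_zero])
  induction i using Fin.lastCases with
  | last =>
    apply hi
    rw [pderiv_last_cyclicCover, map_neg, map_mul, map_pow, aeval_X, hyl, zero_pow (by omega),
      mul_zero, neg_zero]
  | cast i => exact hi (by rw [pderiv_castSucc_cyclicCover, hyx, hs])

end CyclicCover

/-! ### Consequences of smoothness: irreducibility, and the characteristic dividing `k` -/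

theorem absolutelyIrreducible_of_forall_exists_pderiv_ne_zero {K : Type*} [Field K] {n d : ℕ}
    (hn : 3 ≤ n) (hd : 0 < d) {G : MvPolynomial (Fin n) K} (hG : G.IsHomogeneous d) (hG0 : G ≠ 0)
    (hs : ∀ x : Fin n → AlgebraicClosure K, x ≠ 0 → ∃ i, aeval x (pderiv i G) ≠ 0) :
    AbsolutelyIrreducible G := by
  have hne : map (algebraMap K (AlgebraicClosure K)) G ≠ 0 :=
    (map_ne_zero_iff _ (map_injective _ (algebraMap K (AlgebraicClosure K)).injective)).2 hG0
  have hh := hG.map (algebraMap K (AlgebraicClosure K))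
  constructor
  · intro hu
    have h1 := (isUnit_iff_totalDegree_of_isReduced.1 hu).2
    rw [hh.totalDegree hne] at h1
    omega
  · intro A B hAB
    by_contra! hcon
    rw [hAB] at hh hne
    have hA := aeval_zero_eq_zero_of_mul_isHomogeneous hh hne hcon.1
    rw [mul_comm] at hh hne
    have hB := aeval_zero_eq_zero_of_mul_isHomogeneous hh hne hcon.2
    obtain ⟨x, hx, hxA, hxB⟩ := exists_common_zero_ne_zero hn hA hB
    obtain ⟨i, hi⟩ := hs x hx
    apply hi
    rw [← aeval_map_algebraMap (AlgebraicClosure K), ← pderiv_map, hAB, Derivation.leibniz]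
    rw [map_add, smul_eq_mul, smul_eq_mul, map_mul, map_mul, hxA, hxB, zero_mul, zero_mul, add_zero]

/-- A form of degree `q - 1` in at least two variables cannot take the value `1` at all nonzero
rational points, since its values sum to zero over `K ^ n`. -/
theorem exists_eval_pow_ne_one {K : Type*} [Field K] [Fintype K] {n : ℕ} (hn : 2 ≤ n)
    {f : MvPolynomial (Fin n) K} (hf : f.IsHomogeneous (Fintype.card K - 1)) :
    ∃ x : Fin n → K, x ≠ 0 ∧ eval x f ≠ 1 := by
  classical
  by_contra! h
  have hq := Fintype.one_lt_card (α := K)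
  have hsum := MvPolynomial.sum_eval_eq_zero f (by
    rw [Fintype.card_fin]
    refine hf.totalDegree_le.trans_lt ?_
    nlinarith [Nat.sub_pos_of_lt hq])
  have h0 : eval (0 : Fin n → K) f = 0 := by
    have := aeval_smul_of_isHomogeneous (A := K) hf (0 : K) (0 : Fin n → K)
    rwa [aeval_eq_eval, zero_pow (Nat.sub_pos_of_lt hq).ne', zero_mul, zero_smul] at this
  rw [← Finset.add_sum_erase _ _ (Finset.mem_univ (0 : Fin n → K)), h0, zero_add,
    Finset.sum_congr rfl fun x hx => h x (Finset.ne_of_mem_erase hx), Finset.sum_const,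
    Finset.card_erase_of_mem (Finset.mem_univ _), Finset.card_univ, Fintype.card_fun,
    Fintype.card_fin, nsmul_eq_mul, mul_one, Nat.cast_sub (Nat.one_le_pow _ _ (by omega)),
    Nat.cast_pow, FiniteField.cast_card_eq_zero, zero_pow (by omega)] at hsum
  simp at hsum

theorem pderiv_comm {σ R : Type*} [CommRing R] (i j : σ) (f : MvPolynomial σ R) :
    pderiv i (pderiv j f) = pderiv j (pderiv i f) := by
  classical
  have h : ⁅pderiv (R := R) i, pderiv j⁆ = (0 : Derivation R (MvPolynomial σ R) (MvPolynomial σ R)) := by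
    refine derivation_ext fun l => ?_
    simp only [Derivation.commutator_apply, pderiv_X, Pi.single_apply, Derivation.coe_zero,
      Pi.zero_apply]
    split_ifs <;> simp
  have := DFunLike.congr_fun h f
  rwa [Derivation.commutator_apply, Derivation.coe_zero, Pi.zero_apply, sub_eq_zero] at this

/-- If `d * G ^ k = ∑ i, G_i * X_i ^ q` with `G` smooth at the rational points, then the
characteristic divides `k`: otherwise differentiating gives `G ^ (k - 1) = 1` at all nonzero
rational points. -/
theorem cast_eq_zero_of_smooth {K : Type*} [Field K] [Fintype K] {n d k : ℕ} (hn : 2 ≤ n)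
    (hd : 0 < d) (hdK : (d : K) ≠ 0) (hk : k * d = d - 1 + Fintype.card K) {G : MvPolynomial (Fin n) K}
    (hG : G.IsHomogeneous d) (hs : ∀ x : Fin n → K, x ≠ 0 → ∃ i, eval x (pderiv i G) ≠ 0)
    (h : C (d : K) * G ^ k = ∑ i, pderiv i G * X i ^ Fintype.card K) : (k : K) = 0 := by
  have hq := Fintype.one_lt_card (α := K)
  have hk1 : 1 ≤ k := by
    by_contra hk0
    have : k = 0 := by omega
    subst this
    omega
  have hkK : (k : K) * d = d - 1 := by
    have := congrArg (Nat.cast (R := K)) hk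
    rwa [Nat.cast_mul, Nat.cast_add, FiniteField.cast_card_eq_zero, add_zero,
      Nat.cast_sub hd, Nat.cast_one] at this
  by_contra hkp
  have hd1 : (d : K) - 1 ≠ 0 := hkK ▸ mul_ne_zero hkp hdK
  -- The degree is `(k - 1) d = k d - d = q - 1`.
  obtain ⟨x, hx, hx1⟩ := exists_eval_pow_ne_one hn (f := G ^ (k - 1)) (by
    convert hG.pow (k - 1) using 1
    rw [mul_comm, Nat.sub_mul, hk]
    omega)
  obtain ⟨j, hj⟩ := hs x hx
  apply hx1
  have hEuler := congrArg (eval x) (hG.pderiv (i := j)).sum_X_mul_pderiv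
  rw [nsmul_eq_mul, map_mul, map_natCast, Nat.cast_sub hd, Nat.cast_one] at hEuler
  -- The derivative of `X_i^q` is zero, and `x_i^q = x_i` turns the rest into the Euler sum of
  -- `G_j`, of degree `d - 1`.
  have hR : eval x (pderiv j (∑ i, pderiv i G * X i ^ Fintype.card K)) =
      eval x (∑ i, X i * pderiv i (pderiv j G)) := by
    simp only [map_sum, Derivation.leibniz, Derivation.leibniz_pow, map_add, map_mul, map_pow,
      eval_X, smul_eq_mul, nsmul_eq_mul, map_natCast, FiniteField.cast_card_eq_zero, zero_mul,
      mul_zero, zero_add, FiniteField.pow_card, pderiv_comm j]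
  rw [← h, hEuler, pderiv_C_mul, Derivation.leibniz_pow] at hR
  simp only [map_mul, map_pow, smul_eq_mul, nsmul_eq_mul, map_natCast] at hR
  refine mul_left_cancel₀ (mul_ne_zero hd1 hj) ?_
  rw [map_pow, mul_one]
  refine Eq.trans ?_ hR
  rw [← hkK]
  ring

end FrobNC

/-! ### The main theorem -/

theorem mainTheorem5 {K : Type*} [Field K] [Fintype K] (p q : ℕ) [Fact p.Prime] [CharP K p]
    (hq : Fintype.card K = q) (n d : ℕ) (hn : 2 ≤ n) (hd : 2 < d) (hpd : ¬ p ∣ d)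
    (G : MvPolynomial (Fin n) K) (F : MvPolynomial (Fin (n + 1)) K)
    (hFG : F = MvPolynomial.rename Fin.castSucc G - MvPolynomial.X (Fin.last n) ^ d)
    (hF : F.IsHomogeneous d)
    (hirr : FrobNC.AbsolutelyIrreducible F)
    (hsm : FrobNC.IsSmoothHypersurface F) :
    (FrobNC.IsFrobeniusNonclassical q F ↔
      ∃ k : ℕ, 0 < k ∧ k * d = d - 1 + q ∧ p ∣ k ∧
        G ^ k = ∑ i : Fin n, MvPolynomial.pderiv i G * MvPolynomial.X i ^ q) ∧
    (FrobNC.IsFrobeniusNonclassical q F →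
      FrobNC.IsFrobeniusNonclassical q G ∧
        (3 ≤ n → FrobNC.AbsolutelyIrreducible G)) := by
  subst hFG hq
  have hdK : (d : K) ≠ 0 := fun h => hpd ((CharP.cast_eq_zero_iff K p d).1 h)
  have hq := Fintype.one_lt_card (α := K)
  have hG : G.IsHomogeneous d := by
    have h := hF.add (isHomogeneous_X_pow (R := K) (Fin.last n) d)
    rw [sub_add_cancel] at h
    exact (IsHomogeneous.rename_isHomogeneous_iff (Fin.castSucc_injective n)).1 h
  have hs := FrobNC.exists_pderiv_ne_zero_of_isSmoothHypersurface_cyclicCover (by omega) hdK hG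
    hF hsm
  have hG0 : G ≠ 0 := by
    rintro rfl
    obtain ⟨i, hi⟩ := hs (fun _ => 1) (fun h => one_ne_zero (congrFun h ⟨0, by omega⟩))
    simp at hi
  have hs' : ∀ x : Fin n → K, x ≠ 0 → ∃ i, eval x (pderiv i G) ≠ 0 := by
    intro x hx
    have hinj := (algebraMap K (AlgebraicClosure K)).injective
    obtain ⟨i, hi⟩ := hs (algebraMap K (AlgebraicClosure K) ∘ x) (fun h => hx (funext fun i =>
      hinj (by simpa using congrFun h i)))
    refine ⟨i, fun h => hi ?_⟩
    have h2 := aeval_algebraMap_apply (AlgebraicClosure K) x (pderiv i G)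
    rwa [aeval_eq_eval, h, map_zero] at h2
  -- Reading `k d = d - 1 + q` in `K`, where `k = q = 0`, leaves `d = 1`.
  have hd1 : ∀ k : ℕ, k * d = d - 1 + Fintype.card K → (k : K) = 0 → (d : K) = 1 := by
    intro k hk hk0
    have := congrArg (Nat.cast (R := K)) hk
    rw [Nat.cast_mul, Nat.cast_add, FiniteField.cast_card_eq_zero, add_zero,
      Nat.cast_sub (by omega), Nat.cast_one, hk0, zero_mul] at this
    exact sub_eq_zero.1 this.symm
  have hiff : FrobNC.IsFrobeniusNonclassical (Fintype.card K)
      (rename Fin.castSucc G - X (Fin.last n) ^ d) ↔ ∃ k : ℕ, 0 < k ∧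
        k * d = d - 1 + Fintype.card K ∧ p ∣ k ∧
        G ^ k = ∑ i : Fin n, pderiv i G * X i ^ Fintype.card K := by
    constructor
    · intro h
      obtain ⟨k, hk, hGk⟩ := FrobNC.exists_eq_of_isFrobeniusNonclassical_cyclicCover (by omega)
        hdK (by omega) hG0 hF hirr h
      have hk0 := FrobNC.cast_eq_zero_of_smooth hn (by omega) hdK hk hG hs' hGk
      refine ⟨k, Nat.pos_of_ne_zero ?_, hk, (CharP.cast_eq_zero_iff K p k).1 hk0, ?_⟩
      · rintro rfl
        omega
      · rw [← hGk, hd1 k hk hk0, C_1, one_mul]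
    · rintro ⟨k, -, hk, hpk, hGk⟩
      rw [FrobNC.isFrobeniusNonclassical_iff hF]
      intro x _ hx0 _
      have h1 := congrArg (aeval x) (FrobNC.sum_pderiv_cyclicCover (d := d) G
        (Fintype.card K))
      have hdC : ((d : ℕ) : MvPolynomial (Fin (n + 1)) K) = 1 := by
        rw [← C_eq_coe_nat, hd1 k hk ((CharP.cast_eq_zero_iff K p k).2 hpk), C_1]
      rw [← hGk, hdC, one_mul, ← hk, mul_comm k d, pow_mul, map_pow, map_sub, map_pow] at h1
      rw [map_sub, sub_eq_zero] at hx0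
      rw [hx0, map_pow (aeval x) (X (Fin.last n) ^ d), sub_self] at h1
      simpa only [map_sum, map_mul, map_pow, aeval_X] using h1
  refine ⟨hiff, fun h => ⟨?_, fun hn3 =>
    FrobNC.absolutelyIrreducible_of_forall_exists_pderiv_ne_zero hn3 (by omega) hG hG0 hs⟩⟩
  obtain ⟨k, hk0, -, -, hGk⟩ := hiff.1 h
  rw [FrobNC.isFrobeniusNonclassical_iff hG]
  intro x _ hx0 _
  have h1 := congrArg (aeval x) hGk
  rw [map_pow, hx0, zero_pow hk0.ne'] at h1
  simpa only [map_sum, map_mul, map_pow, aeval_X] using h1.symm
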